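/- **Setting.** Let $\Omega_1,\Omega_2\subset\mathbb R^d$ be bounded open sets with Lipschitz boundary, $\Omega=\Omega_1\cup\Omega_2$, and let $\Gamma_i=\partial\Omega_i\cap\Omega$ $(i=1,2)$ be the ports. Assume that there is a Lipschitz partition of unity $\phi_1,\phi_2:\Omega\to[0,1]$, that is, $\phi_1+\phi_2=1$ on $\Omega$ and $\phi_i=0$ on $\Omega\setminus\Omega_i$. Let $\mathcal X$ be a closed subspace of $H^1(\Omega)$ with $H^1_0(\Omega)\subset\mathcal X\subset H^1(\Omega)$, and put $$\mathcal X_i=\{v|_{\Omega_i}:v\in\mathcal X\},\quad \mathcal X_{i,0}=\{v\in\mathcal X_i: v|_{\Gamma_i}=0\},\quad \mathcal U_i=\{v|_{\Gamma_i}:v\in\mathcal X_i\},$$ where $v|_{\Gamma_i}$ denotes the trace. Assume that for every $v\in\mathcal X_{i,0}$ the trivial extension $v^{\rm ext}$ (equal to $v$ on $\Omega_i$ and to $0$ on $\Omega\setminus\Omega_i$) belongs to $\mathcal X$, and that $\phi_i v\in\mathcal X$ for every $v\in\mathcal X$ $(i=1,2)$. Let $a:\mathcal X\times\mathcal X\to\mathbb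 R$ be a continuous and coercive bilinear form (with respect to the $H^1(\Omega)$ norm), which is local in the sense that there are bilinear forms on $\mathcal X_i\times\mathcal X_{i,0}$, $i=1,2$, again denoted by $a$, with $$a(u,v^{\rm ext})=a(u|_{\Omega_i},v)\qquad\forall\,u\in\mathcal X,\ v\in\mathcal X_{i,0}.$$ Let $\mathcal U=\mathcal U_1\times\mathcal U_2$ carry the inner product $\langle w,v\rangle=\sum_{i=1}^2(w_i,v_i)_{H^{1/2}(\Gamma_i)}$ and the norm $|||w|||=\sqrt{\langle w,w\rangle}$, where $$(g,h)_{H^{1/2}(\Gamma)}=\int_\Gamma gh\,d\sigma+\int_\Gamma\int_\Gamma\frac{(g(x)-g(y))(h(x)-h(y))}{|x-y|^d}\,d\sigma(x)\,d\sigma(y).$$ Let $T_i:\mathcal U_i\to\mathcal X_i$ be the local solution operator, defined by $$(T_i\lambda)|_{\Gamma_i}=\lambda,\qquad a(T_i\lambda,v)=0\quad\forall\,v\in\mathcal X_{i,0},$$ let $\chi_{\Gamma_1}:\mathcal X_2\to\mathcal U_1$ and $\chi_{\Gamma_2}:\mathcal X_1\to\mathcal U_2$ be the trace operators, and let $T:\mathcal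 U\to\mathcal U$ and $a_{\rm p}:\mathcal U\times\mathcal U\to\mathbb R$ be $$T\lambda=\big(\chi_{\Gamma_1}T_2\lambda_2,\ \chi_{\Gamma_2}T_1\lambda_1\big),\qquad a_{\rm p}(\lambda,v)=\langle\lambda-T\lambda,v\rangle .$$ **Proposition.** If $T$ is compact, then $a_{\rm p}$ is inf-sup stable and continuous, that is, $$\alpha_{\rm p}=\inf_{w\in\mathcal U\setminus\{0\}}\ \sup_{v\in\mathcal U\setminus\{0\}}\frac{a_{\rm p}(w,v)}{|||w|||\,|||v|||}>0,\qquad \gamma_{\rm p}=\sup_{w\in\mathcal U\setminus\{0\}}\ \sup_{v\in\mathcal U\setminus\{0\}}\frac{a_{\rm p}(w,v)}{|||w|||\,|||v|||}<\infty .$$ -/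

import Mathlib

open MeasureTheory Set Filter Topology
open scoped ENNReal NNReal ContDiff

noncomputable section

namespace OverlappingSchwarz

/-- The Euclidean space `ℝ^d`. -/
abbrev E (d : ℕ) : Type := EuclideanSpace ℝ (Fin d)

/-! ### Linear maps given by their graph -/

/-- The linear map whose graph is the linear relation `R`, when `R` is the graph of an everywhere
defined single-valued map (and `0`, by convention, otherwise). -/
def linearOfGraph {M N : Type*} [AddCommGroup M] [Module ℝ M] [AddCommGroup N] [Module ℝ N]
    (R : Submodule ℝ (M × N)) : M →ₗ[ℝ] N := by
  classical
  exact
    if h : ∀ x, ∃! y, (x, y) ∈ R then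
      { toFun := fun x => (h x).choose
        map_add' := fun x x' =>
          ((h (x + x')).choose_spec.2 _
            (R.add_mem (h x).choose_spec.1 (h x').choose_spec.1)).symm
        map_smul' := fun c x =>
          ((h (c • x)).choose_spec.2 _ (R.smul_mem c (h x).choose_spec.1)).symm }
    else 0

theorem linearOfGraph_mem {M N : Type*} [AddCommGroup M] [Module ℝ M] [AddCommGroup N]
    [Module ℝ N] (R : Submodule ℝ (M × N)) (h : ∀ x, ∃! y, (x, y) ∈ R) (x : M) :
    (x, linearOfGraph R x) ∈ R := by
  rw [linearOfGraph, dif_pos h]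
  exact (h x).choose_spec.1

/-! ### Sobolev spaces -/

section Sobolev

variable {d : ℕ}

/-- Test functions on `Ω`: smooth, with compact support contained in `Ω`. -/
def IsTest (Ω : Set (E d)) (ψ : E d → ℝ) : Prop :=
  ContDiff ℝ ∞ ψ ∧ HasCompactSupport ψ ∧ tsupport ψ ⊆ Ω

/-- `G` is the weak gradient of `u` on `Ω`. -/
def IsWeakGradient (Ω : Set (E d)) (u : E d → ℝ) (G : E d → E d) : Prop :=
  ∀ ψ, IsTest Ω ψ → ∫ x in Ω, u x • gradient ψ x = - ∫ x in Ω, ψ x • G x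

theorem IsTest.continuous_gradient {Ω : Set (E d)} {ψ : E d → ℝ} (h : IsTest Ω ψ) :
    Continuous (gradient ψ) :=
  (InnerProductSpace.toDual ℝ (E d)).symm.continuous.comp
    (h.1.continuous_fderiv (by simp))

theorem gradient_eq_zero_of_notMem {ψ : E d → ℝ} {x : E d} (hx : x ∉ tsupport ψ) :
    gradient ψ x = 0 := by
  have : fderiv ℝ ψ x = 0 := by
    by_contra hne
    exact hx (support_fderiv_subset ℝ (f := ψ) hne)
  simp [gradient, this]

theorem IsTest.memLp {Ω : Set (E d)} {ψ : E d → ℝ} (h : IsTest Ω ψ) :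
    MemLp ψ 2 (volume.restrict Ω) :=
  (h.1.continuous.memLp_of_hasCompactSupport h.2.1).restrict Ω

theorem IsTest.memLp_gradient {Ω : Set (E d)} {ψ : E d → ℝ} (h : IsTest Ω ψ) :
    MemLp (gradient ψ) 2 (volume.restrict Ω) := by
  refine (h.continuous_gradient.memLp_of_hasCompactSupport ?_).restrict Ω
  refine HasCompactSupport.of_support_subset_isCompact h.2.1 ?_
  intro x hx
  by_contra hne
  exact hx (gradient_eq_zero_of_notMem hne)

/-- The space of pairs `(u, G)`, `u ∈ L²(Ω)`, `G ∈ L²(Ω; ℝ^d)`, with the Hilbert norm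
`(‖u‖² + ‖G‖²)^{1/2}`. -/
abbrev L2Pair (Ω : Set (E d)) : Type :=
  WithLp 2 (Lp ℝ 2 (volume.restrict Ω) × Lp (E d) 2 (volume.restrict Ω))

/-- The subspace of the pairs `(u, G)` for which `G` is the weak gradient of `u`. -/
def sobolevPairs (Ω : Set (E d)) : Submodule ℝ (L2Pair Ω) where
  carrier := {p | IsWeakGradient Ω p.fst p.snd}
  zero_mem' := by
    intro ψ _
    have h1 : ((0 : L2Pair Ω).fst : E d → ℝ) =ᵐ[volume.restrict Ω] 0 :=
      Lp.coeFn_zero ℝ 2 (volume.restrict Ω)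
    have h2 : ((0 : L2Pair Ω).snd : E d → E d) =ᵐ[volume.restrict Ω] 0 :=
      Lp.coeFn_zero (E d) 2 (volume.restrict Ω)
    rw [integral_congr_ae (g := fun _ => 0) (by filter_upwards [h1] with x hx; rw [hx, Pi.zero_apply, zero_smul]),
      integral_congr_ae (f := fun x => ψ x • _) (g := fun _ => 0)
        (by filter_upwards [h2] with x hx; rw [hx, Pi.zero_apply, smul_zero])]
    simp
  add_mem' := by
    intro p q hp hq ψ hψ
    have h1 : ((p + q).fst : E d → ℝ) =ᵐ[volume.restrict Ω] _ := Lp.coeFn_add p.fst q.fst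
    have h2 : ((p + q).snd : E d → E d) =ᵐ[volume.restrict Ω] _ := Lp.coeFn_add p.snd q.snd
    have i1 : ∀ r : L2Pair Ω, Integrable (fun x => r.fst x • gradient ψ x) (volume.restrict Ω) :=
      fun r => memLp_one_iff_integrable.1 (MemLp.smul hψ.memLp_gradient (Lp.memLp r.fst))
    have i2 : ∀ r : L2Pair Ω, Integrable (fun x => ψ x • r.snd x) (volume.restrict Ω) :=
      fun r => memLp_one_iff_integrable.1 (MemLp.smul (Lp.memLp r.snd) hψ.memLp)
    rw [integral_congr_ae (g := fun x => p.fst x • gradient ψ x + q.fst x • gradient ψ x)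
        (by filter_upwards [h1] with x hx; rw [hx, Pi.add_apply, add_smul]),
      integral_congr_ae (f := fun x => ψ x • _) (g := fun x => ψ x • p.snd x + ψ x • q.snd x)
        (by filter_upwards [h2] with x hx; rw [hx, Pi.add_apply, smul_add]),
      integral_add (i1 p) (i1 q), integral_add (i2 p) (i2 q), hp ψ hψ, hq ψ hψ, neg_add]
  smul_mem' := by
    intro c p hp ψ hψ
    have h1 : ((c • p).fst : E d → ℝ) =ᵐ[volume.restrict Ω] _ := Lp.coeFn_smul c p.fst
    have h2 : ((c • p).snd : E d → E d) =ᵐ[volume.restrict Ω] _ := Lp.coeFn_smul c p.snd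
    rw [integral_congr_ae (g := fun x => c • (p.fst x • gradient ψ x))
        (by filter_upwards [h1] with x hx; rw [hx, Pi.smul_apply, smul_assoc]),
      integral_congr_ae (f := fun x => ψ x • _) (g := fun x => c • (ψ x • p.snd x))
        (by filter_upwards [h2] with x hx; rw [hx, Pi.smul_apply, smul_comm]),
      integral_smul, integral_smul, hp ψ hψ, smul_neg]

/-- `H¹(Ω)`: an element is a function `u ∈ L²(Ω)` together with its weak gradient `∇u ∈ L²(Ω)`; the
inner product is `∫ u v + ∫ ∇u · ∇v`. -/
def H1 (Ω : Set (E d)) : Type := sobolevPairs Ω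

instance (Ω : Set (E d)) : NormedAddCommGroup (H1 Ω) :=
  inferInstanceAs (NormedAddCommGroup (sobolevPairs Ω))

instance (Ω : Set (E d)) : InnerProductSpace ℝ (H1 Ω) :=
  inferInstanceAs (InnerProductSpace ℝ (sobolevPairs Ω))

/-- The pair `(u, ∇u)`. -/
def H1.pair {Ω : Set (E d)} (u : H1 Ω) : L2Pair Ω := Subtype.val (p := (· ∈ sobolevPairs Ω)) u

/-- The function underlying an element of `H¹(Ω)` (defined up to null sets of `Ω`). -/
def H1.fn {Ω : Set (E d)} (u : H1 Ω) : E d → ℝ := u.pair.fst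

theorem H1.memLp_fn {Ω : Set (E d)} (u : H1 Ω) : MemLp u.fn 2 (volume.restrict Ω) :=
  Lp.memLp _

theorem H1.fn_zero {Ω : Set (E d)} : H1.fn (0 : H1 Ω) =ᵐ[volume.restrict Ω] 0 :=
  Lp.coeFn_zero ℝ 2 (volume.restrict Ω)

theorem H1.fn_add {Ω : Set (E d)} (u v : H1 Ω) :
    H1.fn (u + v) =ᵐ[volume.restrict Ω] u.fn + v.fn :=
  Lp.coeFn_add _ _

theorem H1.fn_smul {Ω : Set (E d)} (c : ℝ) (u : H1 Ω) :
    H1.fn (c • u) =ᵐ[volume.restrict Ω] c • u.fn :=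
  Lp.coeFn_smul _ _

/-- `H¹₀(Ω)`: the closure of the test functions in `H¹(Ω)`. -/
def H10 (Ω : Set (E d)) : Submodule ℝ (H1 Ω) :=
  (Submodule.span ℝ {u : H1 Ω | ∃ ψ, IsTest Ω ψ ∧ u.fn =ᵐ[volume.restrict Ω] ψ}).topologicalClosure

/-- Restriction of `L²` functions to a smaller set. -/
def restrictLp {F : Type*} [NormedAddCommGroup F] [NormedSpace ℝ F] {Ω' Ω : Set (E d)}
    (h : Ω' ⊆ Ω) : Lp F 2 (volume.restrict Ω) →ₗ[ℝ] Lp F 2 (volume.restrict Ω') where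
  toFun f := ((Lp.memLp f).mono_measure (Measure.restrict_mono_set volume h)).toLp f
  map_add' f g := by
    rw [← MemLp.toLp_add]
    exact MemLp.toLp_congr _ _
      (ae_mono (Measure.restrict_mono_set volume h) (Lp.coeFn_add f g))
  map_smul' c f := by
    rw [RingHom.id_apply, ← MemLp.toLp_const_smul]
    exact MemLp.toLp_congr _ _
      (ae_mono (Measure.restrict_mono_set volume h) (Lp.coeFn_smul c f))

theorem restrictLp_ae {F : Type*} [NormedAddCommGroup F] [NormedSpace ℝ F] {Ω' Ω : Set (E d)}
    (h : Ω' ⊆ Ω) (f : Lp F 2 (volume.restrict Ω)) :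
    (restrictLp h f : E d → F) =ᵐ[volume.restrict Ω'] f :=
  MemLp.coeFn_toLp ((Lp.memLp f).mono_measure (Measure.restrict_mono_set volume h))

theorem IsTest.mono {Ω' Ω : Set (E d)} (h : Ω' ⊆ Ω) {ψ : E d → ℝ} (hψ : IsTest Ω' ψ) :
    IsTest Ω ψ :=
  ⟨hψ.1, hψ.2.1, hψ.2.2.trans h⟩

/-- The restriction `u ↦ u|_{Ω'}`, from `H¹(Ω)` to `H¹(Ω')`. -/
def H1.restrict {Ω' Ω : Set (E d)} (h : Ω' ⊆ Ω) : H1 Ω →ₗ[ℝ] H1 Ω' where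
  toFun u := Subtype.mk (p := (· ∈ sobolevPairs Ω')) (WithLp.toLp 2
      (restrictLp h u.pair.fst, restrictLp h u.pair.snd)) <| by
    intro ψ hψ
    have key : ∀ f : E d → E d, (∀ x, x ∉ Ω' → f x = 0) →
        ∫ x in Ω', f x = ∫ x in Ω, f x := by
      intro f hf
      rw [setIntegral_eq_integral_of_forall_compl_eq_zero hf,
        setIntegral_eq_integral_of_forall_compl_eq_zero fun x hx => hf x fun hx' => hx (h hx')]
    have h1 := restrictLp_ae h u.pair.fst
    have h2 := restrictLp_ae h u.pair.snd
    have e1 : ∫ x in Ω', (restrictLp h u.pair.fst) x • gradient ψ x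
        = ∫ x in Ω', u.pair.fst x • gradient ψ x :=
      integral_congr_ae (by filter_upwards [h1] with x hx; rw [hx])
    have e2 : ∫ x in Ω', ψ x • (restrictLp h u.pair.snd) x
        = ∫ x in Ω', ψ x • u.pair.snd x :=
      integral_congr_ae (by filter_upwards [h2] with x hx; rw [hx])
    refine e1.trans (Eq.trans ?_ (congrArg Neg.neg e2.symm))
    rw [key _ fun x hx => by rw [gradient_eq_zero_of_notMem fun hx' => hx (hψ.2.2 hx'), smul_zero],
      key _ fun x hx => by
        rw [image_eq_zero_of_notMem_tsupport fun hx' => hx (hψ.2.2 hx'), zero_smul]]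
    exact u.property ψ (hψ.mono h)
  map_add' u v := by
    apply Subtype.ext
    apply WithLp.ofLp_injective 2
    exact Prod.ext (map_add (restrictLp h) _ _) (map_add (restrictLp h) _ _)
  map_smul' c u := by
    apply Subtype.ext
    apply WithLp.ofLp_injective 2
    exact Prod.ext (map_smul (restrictLp h) _ _) (map_smul (restrictLp h) _ _)

theorem H1.restrict_ae {Ω' Ω : Set (E d)} (h : Ω' ⊆ Ω) (u : H1 Ω) :
    H1.fn (H1.restrict h u) =ᵐ[volume.restrict Ω'] u.fn :=
  restrictLp_ae h _

end Sobolev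

/-! ### Lipschitz domains, surface measure, `H^{1/2}` and traces -/

section Trace

variable {d : ℕ}

/-- `Ω` has a Lipschitz boundary: near each boundary point, in the direction of some unit vector
`e`, the set `Ω` is the strict epigraph of a Lipschitz function of the component orthogonal
to `e`. -/
def HasLipschitzBoundary (Ω : Set (E d)) : Prop :=
  ∀ x ∈ frontier Ω, ∃ r > 0, ∃ e : E d, ‖e‖ = 1 ∧ ∃ (K : ℝ≥0) (h : E d → ℝ), LipschitzWith K h ∧
    ∀ y ∈ Metric.ball x r, y ∈ Ω ↔ h (y - inner ℝ e y • e) < inner ℝ e y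

/-- The surface measure (normalized `(d-1)`-dimensional Hausdorff measure) on `Γ ⊆ ℝ^d`. -/
def surface (Γ : Set (E d)) : Measure (E d) :=
  (Measure.euclideanHausdorffMeasure (d - 1)).restrict Γ

/-- The fractional difference quotient `(f(x) - f(y)) / |x - y|^{d/2}`; its square has denominator
`|x - y|^d = |x - y|^{(d-1) + 2·(1/2)}`. -/
def diffQuot (f : E d → ℝ) (z : E d × E d) : ℝ :=
  (f z.1 - f z.2) / dist z.1 z.2 ^ ((d : ℝ) / 2)

/-- Pairs of square-integrable functions on `Γ` and on `Γ × Γ`. -/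
abbrev PortPair (Γ : Set (E d)) : Type :=
  WithLp 2 (Lp ℝ 2 (surface Γ) × Lp ℝ 2 ((surface Γ).prod (surface Γ)))

/-- The subspace of the pairs `(g, q)` for which `q` is the fractional difference quotient
of `g`. -/
def slobodeckijPairs (Γ : Set (E d)) : Submodule ℝ (PortPair Γ) where
  carrier := {p | ∃ f : E d → ℝ, p.fst =ᵐ[surface Γ] f ∧
    p.snd =ᵐ[(surface Γ).prod (surface Γ)] diffQuot f}
  zero_mem' := ⟨0, Lp.coeFn_zero ℝ 2 _, by
    refine (Lp.coeFn_zero ℝ 2 ((surface Γ).prod (surface Γ))).trans (Eventually.of_forall ?_)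
    intro z
    simp [diffQuot]⟩
  add_mem' := by
    rintro p q ⟨f, hf, hf'⟩ ⟨g, hg, hg'⟩
    refine ⟨f + g, (Lp.coeFn_add p.fst q.fst).trans (hf.add hg),
      (Lp.coeFn_add p.snd q.snd).trans ((hf'.add hg').trans (Eventually.of_forall ?_))⟩
    intro z
    simp only [diffQuot, Pi.add_apply]
    ring
  smul_mem' := by
    rintro c p ⟨f, hf, hf'⟩
    refine ⟨c • f, (Lp.coeFn_smul c p.fst).trans (hf.const_smul c),
      (Lp.coeFn_smul c p.snd).trans ((hf'.const_smul c).trans (Eventually.of_forall ?_))⟩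
    intro z
    simp only [diffQuot, Pi.smul_apply, smul_eq_mul]
    ring

/-- The Sobolev–Slobodeckij space `H^{1/2}(Γ)`: a function `g ∈ L²(Γ)` together with its difference
quotient, which is required to be in `L²(Γ × Γ)`. The inner product is
`∫_Γ g h + ∫_Γ ∫_Γ (g(x) - g(y)) (h(x) - h(y)) / |x - y|^d`. -/
def HHalf (Γ : Set (E d)) : Type := slobodeckijPairs Γ

instance (Γ : Set (E d)) : NormedAddCommGroup (HHalf Γ) :=
  inferInstanceAs (NormedAddCommGroup (slobodeckijPairs Γ))

instance (Γ : Set (E d)) : InnerProductSpace ℝ (HHalf Γ) :=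
  inferInstanceAs (InnerProductSpace ℝ (slobodeckijPairs Γ))

/-- The function underlying an element of `H^{1/2}(Γ)` (defined up to null sets of `Γ`). -/
def HHalf.fn {Γ : Set (E d)} (g : HHalf Γ) : E d → ℝ :=
  (Subtype.val (p := (· ∈ slobodeckijPairs Γ)) g).fst

theorem HHalf.fn_zero {Γ : Set (E d)} : HHalf.fn (0 : HHalf Γ) =ᵐ[surface Γ] 0 :=
  Lp.coeFn_zero ℝ 2 (surface Γ)

theorem HHalf.fn_add {Γ : Set (E d)} (g h : HHalf Γ) :
    HHalf.fn (g + h) =ᵐ[surface Γ] g.fn + h.fn :=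
  Lp.coeFn_add _ _

theorem HHalf.fn_smul {Γ : Set (E d)} (c : ℝ) (g : HHalf Γ) :
    HHalf.fn (c • g) =ᵐ[surface Γ] c • g.fn :=
  Lp.coeFn_smul _ _

/-- `g` is the trace on `Γ ⊆ closure D` of the function `v` defined on `D`: for almost every
`x ∈ Γ` with respect to the surface measure,
`lim_{r → 0} ⨍_{B(x,r) ∩ D} |v(y) - g(x)| dy = 0`. -/
def HasTrace (D Γ : Set (E d)) (v g : E d → ℝ) : Prop :=
  ∀ᵐ x ∂(surface Γ),
    Tendsto (fun r : ℝ => ⨍⁻ y in Metric.ball x r ∩ D, ‖v y - g x‖ₑ ∂volume) (𝓝[>] 0) (𝓝 0)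

theorem HasTrace.congr {D Γ : Set (E d)} {v v' g g' : E d → ℝ} (h : HasTrace D Γ v g)
    (hv : v' =ᵐ[volume.restrict D] v) (hg : g' =ᵐ[surface Γ] g) : HasTrace D Γ v' g' := by
  filter_upwards [h, hg] with x hx hgx
  refine hx.congr fun r => ?_
  refine laverage_congr ?_
  filter_upwards [ae_mono (Measure.restrict_mono_set volume inter_subset_right) hv] with y hy
  rw [hy, hgx]

theorem HasTrace.zero {D Γ : Set (E d)} : HasTrace D Γ 0 0 :=
  Eventually.of_forall fun x => by simp

theorem HasTrace.add {D Γ : Set (E d)} {v v' g g' : E d → ℝ} (h : HasTrace D Γ v g)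
    (h' : HasTrace D Γ v' g') (hv : AEMeasurable v (volume.restrict D)) :
    HasTrace D Γ (v + v') (g + g') := by
  filter_upwards [h, h'] with x hx hx'
  have hsum := hx.add hx'
  rw [add_zero] at hsum
  refine tendsto_of_tendsto_of_tendsto_of_le_of_le tendsto_const_nhds hsum (fun _ => zero_le)
    fun r => ?_
  have hvr : AEMeasurable (fun y => ‖v y - g x‖ₑ) (volume.restrict (Metric.ball x r ∩ D)) :=
    ((hv.mono_measure (Measure.restrict_mono_set volume inter_subset_right)).sub_const _).enorm
  simp only [laverage_eq]
  rw [← ENNReal.add_div, ← lintegral_add_left' hvr]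
  gcongr with y
  simp only [Pi.add_apply]
  rw [add_sub_add_comm]
  exact enorm_add_le _ _

theorem HasTrace.smul {D Γ : Set (E d)} {v g : E d → ℝ} (c : ℝ) (h : HasTrace D Γ v g) :
    HasTrace D Γ (c • v) (c • g) := by
  filter_upwards [h] with x hx
  have hmul := ENNReal.Tendsto.const_mul (a := ‖c‖ₑ) hx (Or.inr enorm_ne_top)
  rw [mul_zero] at hmul
  refine hmul.congr fun r => ?_
  simp only [laverage_eq, Pi.smul_apply, smul_eq_mul]
  rw [← mul_div_assoc, ← lintegral_const_mul' _ _ enorm_ne_top]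
  congr 2
  ext y
  rw [← enorm_mul, mul_sub]

/-- `g ∈ H^{1/2}(Γ)` is the trace on `Γ` of `v ∈ H¹(D)`. -/
def H1.IsTrace {D Γ : Set (E d)} (v : H1 D) (g : HHalf Γ) : Prop :=
  HasTrace D Γ v.fn g.fn

theorem H1.IsTrace.zero {D Γ : Set (E d)} : (0 : H1 D).IsTrace (0 : HHalf Γ) :=
  HasTrace.zero.congr H1.fn_zero HHalf.fn_zero

theorem H1.IsTrace.add {D Γ : Set (E d)} {v w : H1 D} {g h : HHalf Γ} (hv : v.IsTrace g)
    (hw : w.IsTrace h) : (v + w).IsTrace (g + h) :=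
  (HasTrace.add hv hw v.memLp_fn.aestronglyMeasurable.aemeasurable).congr
    (H1.fn_add _ _) (HHalf.fn_add _ _)

theorem H1.IsTrace.smul {D Γ : Set (E d)} {v : H1 D} {g : HHalf Γ} (c : ℝ) (hv : v.IsTrace g) :
    (c • v).IsTrace (c • g) :=
  (HasTrace.smul c hv).congr (H1.fn_smul _ _) (HHalf.fn_smul _ _)

end Trace

/-! ### Two overlapping subdomains -/

/-- Two bounded Lipschitz open sets `Ω₁`, `Ω₂` of `ℝ^d` (indexed by `Fin 2`). -/
structure Decomposition (d : ℕ) where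
  sub : Fin 2 → Set (E d)
  isOpen_sub : ∀ i, IsOpen (sub i)
  isBounded_sub : ∀ i, Bornology.IsBounded (sub i)
  lipschitz_sub : ∀ i, HasLipschitzBoundary (sub i)

namespace Decomposition

variable {d : ℕ} (D : Decomposition d)

/-- The global domain `Ω = Ω₁ ∪ Ω₂`. -/
def dom : Set (E d) := ⋃ i, D.sub i

theorem sub_subset (i : Fin 2) : D.sub i ⊆ D.dom := subset_iUnion D.sub i

/-- The port `Γ_i`: the part of `∂Ω_i` inside `Ω`. -/
def port (i : Fin 2) : Set (E d) := frontier (D.sub i) ∩ D.dom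

/-- Lipschitz partitions of unity on `Ω` associated with `Ω₁`, `Ω₂`. -/
structure IsPartitionOfUnity (φ : Fin 2 → E d → ℝ) : Prop where
  lipschitz : ∀ i, ∃ K, LipschitzOnWith K (φ i) D.dom
  sum_eq_one : ∀ x ∈ D.dom, ∑ i, φ i x = 1
  nonneg : ∀ i, ∀ x ∈ D.dom, 0 ≤ φ i x
  le_one : ∀ i, ∀ x ∈ D.dom, φ i x ≤ 1
  eq_zero : ∀ i, ∀ x ∈ D.dom, x ∉ D.sub i → φ i x = 0

variable (X : Submodule ℝ (H1 D.dom))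

/-- The local space `X_i = {u|_{Ω_i} : u ∈ X}`. -/
def localSpace (i : Fin 2) : Submodule ℝ (H1 (D.sub i)) :=
  X.map (H1.restrict (D.sub_subset i))

/-- The restriction `X → X_i`, `u ↦ u|_{Ω_i}`. -/
def toLocal (i : Fin 2) : X →ₗ[ℝ] D.localSpace X i :=
  ((H1.restrict (D.sub_subset i)).comp X.subtype).codRestrict _
    fun u => Submodule.mem_map_of_mem u.2

/-- The bubble space `X_{i,0} = {v ∈ X_i : v|_{Γ_i} = 0}`. -/
def bubbleSpace (i : Fin 2) : Submodule ℝ (H1 (D.sub i)) where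
  carrier := {v | v ∈ D.localSpace X i ∧ v.IsTrace (0 : HHalf (D.port i))}
  zero_mem' := ⟨zero_mem _, .zero⟩
  add_mem' hv hw := ⟨add_mem hv.1 hw.1, add_zero (0 : HHalf (D.port i)) ▸ hv.2.add hw.2⟩
  smul_mem' c _ hv :=
    ⟨Submodule.smul_mem _ c hv.1, smul_zero (A := HHalf (D.port i)) c ▸ hv.2.smul c⟩

/-- The port space `U_i = {v|_{Γ_i} : v ∈ X_i}`, with the inner product of `H^{1/2}(Γ_i)`. -/
def portSpace (i : Fin 2) : Submodule ℝ (HHalf (D.port i)) where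
  carrier := {g | ∃ v ∈ D.localSpace X i, v.IsTrace g}
  zero_mem' := ⟨0, zero_mem _, .zero⟩
  add_mem' := by
    rintro g h ⟨v, hv, hg⟩ ⟨w, hw, hh⟩
    exact ⟨v + w, add_mem hv hw, hg.add hh⟩
  smul_mem' := by
    rintro c g ⟨v, hv, hg⟩
    exact ⟨c • v, Submodule.smul_mem _ c hv, hg.smul c⟩

/-- `U = U₁ × U₂`, with inner product `⟨w, v⟩ = ∑ i, (w_i, v_i)_{H^{1/2}(Γ_i)}`. -/
abbrev Ports : Type := PiLp 2 fun i : Fin 2 => D.portSpace X i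

/-- `w ∈ H¹(Ω)` is the trivial extension `v^ext` of `v ∈ H¹(Ω_i)`: it equals `v` on `Ω_i` and `0` on
`Ω \ Ω_i`. -/
def IsZeroExtension (i : Fin 2) (v : H1 (D.sub i)) (w : H1 D.dom) : Prop :=
  w.fn =ᵐ[volume.restrict D.dom] (D.sub i).indicator v.fn

/-- The local forms: for each `i`, the form `a(v, w)` for `v ∈ X_i`, `w ∈ X_{i,0}`. -/
abbrev LocalForms : Type :=
  ∀ i : Fin 2, D.localSpace X i →ₗ[ℝ] D.bubbleSpace X i →ₗ[ℝ] ℝ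

variable {X} (b : D.LocalForms X)

/-- The local solution operator `T_i : U_i → X_i`: `u = T_i λ` is the element of `X_i` with
`u|_{Γ_i} = λ` and `a(u, v) = 0` for all `v ∈ X_{i,0}`. For a closed space `X` and a coercive form
this element exists and is unique (Lax-Milgram on the closed subspace `X_{i,0}`). -/
def localSolve (i : Fin 2) : D.portSpace X i →ₗ[ℝ] D.localSpace X i :=
  linearOfGraph
    { carrier := {p | (p.2 : H1 (D.sub i)).IsTrace (p.1 : HHalf (D.port i)) ∧ ∀ v, b i p.2 v = 0}
      zero_mem' := ⟨.zero, by simp⟩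
      add_mem' := fun hp hq => ⟨hp.1.add hq.1, fun v => by simp [hp.2 v, hq.2 v]⟩
      smul_mem' := fun c _ hp => ⟨hp.1.smul c, fun v => by simp [hp.2 v]⟩ }

variable (X)

/-- The trace operator `χ_{Γ_i} : X_j → U_i` on the port `Γ_i ⊆ Ω_j`, where `j = i.rev` is the other
index. As `Ω₁` and `Ω₂` are bounded Lipschitz sets and `X_j` consists of restrictions of functions in
`H¹(Ω)`, each `v ∈ X_j` has exactly one trace in `U_i`. -/
def crossTrace (i : Fin 2) : D.localSpace X i.rev →ₗ[ℝ] D.portSpace X i :=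
  linearOfGraph
    { carrier := {p | (p.1 : H1 (D.sub i.rev)).IsTrace (p.2 : HHalf (D.port i))}
      zero_mem' := .zero
      add_mem' := fun hp hq => H1.IsTrace.add hp hq
      smul_mem' := fun c _ hp => H1.IsTrace.smul c hp }

variable {X}

/-- The port operator `T λ = (χ_{Γ₁} T₂ λ₂, χ_{Γ₂} T₁ λ₁)`. -/
def portOperator : D.Ports X →ₗ[ℝ] D.Ports X where
  toFun l := WithLp.toLp 2 fun i => D.crossTrace X i (D.localSolve b i.rev (l i.rev))
  map_add' l l' := by ext1 i; simp
  map_smul' c l := by ext1 i; simp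

/-- The port form `a_p(λ, v) = ⟨λ - T λ, v⟩`. -/
def portForm (l v : D.Ports X) : ℝ := inner ℝ (l - D.portOperator b l) v

end Decomposition

/-! ### Stability and continuity constants -/

/-- `inf_w sup_v c(w, v) / (‖w‖ ‖v‖)` over nonzero `w`, `v`, as an extended real number. -/
def infSupConstant {V : Type*} [NormedAddCommGroup V] (c : V → V → ℝ) : EReal :=
  ⨅ (w : V) (_ : w ≠ 0), ⨆ (v : V) (_ : v ≠ 0), ((c w v / (‖w‖ * ‖v‖) : ℝ) : EReal)

/-- `sup_w sup_v c(w, v) / (‖w‖ ‖v‖)` over nonzero `w`, `v`, as an extended real number. -/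
def continuityConstant {V : Type*} [NormedAddCommGroup V] (c : V → V → ℝ) : EReal :=
  ⨆ (w : V) (_ : w ≠ 0), ⨆ (v : V) (_ : v ≠ 0), ((c w v / (‖w‖ * ‖v‖) : ℝ) : EReal)

end OverlappingSchwarz

end

/-! The form is the inner product with `A = I - T`. Testing with `v = A w` shows that inf-sup
stability follows from a bound `C ‖w‖ ≤ ‖A w‖`; continuity is Cauchy–Schwarz, as a compact operator
is bounded. Since `T` is compact, the lower bound is the Riesz alternative: it holds unless 1 is an
eigenvalue of `T`. So everything rests on `T λ = λ` forcing `λ = 0`.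

For a fixed point, the local solutions `u_i = T_i λ_i` have the same trace `λ_i` on `Γ_i` as the
solution on the other subdomain. Uniqueness is shown twice by energy. On the overlap, `u_0 - u_1`
has zero trace on both ports; cut off outside the overlap it is an admissible test function for both
local problems, and coercivity makes it vanish. Hence the `u_i` glue to one `G` in `X`. Writing `G =
φ_0 G + φ_1 G`, each summand is a local test function, so `a(G, G) = 0` and `G = 0`
(`eq_zero_of_local_solutions`).

Traces are limits of averages. The comparison of the two sides of a port rests on the interior
density of Lipschitz sets (`HasLipschitzBoundary.inv_volume_ball_inter_le`). -/

namespace OverlappingSchwarz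

section Auxiliary

variable {d : ℕ}

/-! ### Interior density and traces -/

/-- Above a boundary point, the interior cone of a Lipschitz epigraph contains a ball of radius
proportional to `r` inside `B(x, r)`, so `Ω` fills a fixed fraction of small balls. The inverse form
matches the normalization of averages. -/
theorem HasLipschitzBoundary.inv_volume_ball_inter_le {Ω : Set (E d)}
    (hΩ : HasLipschitzBoundary Ω) {x : E d} (hx : x ∈ frontier Ω) :
    ∃ C : ℝ≥0∞, C ≠ (⊤ : ℝ≥0∞) ∧ ∀ᶠ r in 𝓝[>] (0 : ℝ),
      (volume (Metric.ball x r ∩ Ω))⁻¹ ≤ C * (volume (Metric.ball x r))⁻¹ := by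
  obtain ⟨r₀, hr₀, e, he, K, h, hK, hΩ⟩ := hΩ x hx
  have hinner : Continuous fun y : E d => inner ℝ e y := by fun_prop
  -- Strictly below the graph there would be a neighbourhood of `x` free of points of `Ω`.
  have hxe : h (x - inner ℝ e x • e) ≤ inner ℝ e x := by
    by_contra! hlt
    have hopen : ∀ᶠ y in 𝓝 x, inner ℝ e y < h (y - inner ℝ e y • e) :=
      (hinner.tendsto x).eventually_lt
        ((hK.continuous.comp (continuous_id.sub (hinner.smul continuous_const))).tendsto x) hlt
    obtain ⟨y, hyΩ, hy, hyb⟩ := ((mem_closure_iff_frequently.1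
      (frontier_subset_closure hx)).and_eventually (hopen.and (Metric.ball_mem_nhds x hr₀))).exists
    exact lt_asymm hy ((hΩ y hyb).1 hyΩ)
  -- At height `r/2` above `x`, a displacement `z` with `‖z‖ < r c` changes the height by at most `r
  -- c` and the graph by at most `2 K r c`; this `c` keeps the sum below `r/2`.
  set c : ℝ := 1 / (4 * (K + 1)) with hc
  have hK0 : (0 : ℝ) ≤ K := K.2
  have hc0 : 0 < c := by positivity
  have hcK : 4 * (K * c) + 4 * c = 1 := by rw [hc]; field_simp
  have hc4 : 4 * c ≤ 1 := by nlinarith [mul_nonneg hK0 hc0.le]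
  have hsub : ∀ r, 0 < r → r ≤ r₀ →
      Metric.ball (x + (r / 2) • e) (r * c) ⊆ Metric.ball x r ∩ Ω := by
    intro r hr hr' y hy
    obtain ⟨z, rfl⟩ : ∃ z, y = x + (r / 2) • e + z := ⟨y - (x + (r / 2) • e), by abel⟩
    have hz : ‖z‖ < r * c := by simpa [dist_eq_norm] using hy
    have hyx : x + (r / 2) • e + z ∈ Metric.ball x r := by
      rw [mem_ball_iff_norm, show x + (r / 2) • e + z - x = (r / 2) • e + z by abel]
      refine (norm_add_le _ _).trans_lt ?_
      rw [norm_smul, he, Real.norm_of_nonneg (by positivity)]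
      nlinarith
    refine ⟨hyx, (hΩ _ (Metric.ball_subset_ball hr' hyx)).2 ?_⟩
    have hez : |inner ℝ e z| ≤ ‖z‖ := by simpa [he] using abs_real_inner_le_norm e z
    have hin : inner ℝ e (x + (r / 2) • e + z) = inner ℝ e x + r / 2 + inner ℝ e z := by
      simp [inner_add_right, inner_smul_right, he]
    have hproj : ‖(x + (r / 2) • e + z - inner ℝ e (x + (r / 2) • e + z) • e)
        - (x - inner ℝ e x • e)‖ ≤ 2 * ‖z‖ := by
      rw [hin, show (x + (r / 2) • e + z - (inner ℝ e x + r / 2 + inner ℝ e z) • e)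
        - (x - inner ℝ e x • e) = z - inner ℝ e z • e by module]
      refine (norm_sub_le _ _).trans ?_
      rw [norm_smul, he, Real.norm_eq_abs]
      linarith
    have hlip := hK.norm_sub_le (x + (r / 2) • e + z - inner ℝ e (x + (r / 2) • e + z) • e)
      (x - inner ℝ e x • e)
    rw [Real.norm_eq_abs] at hlip
    have h1 := (abs_le.1 hlip).2
    have h2 := (abs_le.1 hez).1
    have h3 : (K : ℝ) * _ ≤ K * (2 * (r * c)) :=
      mul_le_mul_of_nonneg_left (hproj.trans (by linarith)) hK0
    rw [hin] at *
    nlinarith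
  refine ⟨(volume (Metric.ball (0 : E d) c))⁻¹ * volume (Metric.ball (0 : E d) 1),
    ENNReal.mul_ne_top (ENNReal.inv_ne_top.2 (Metric.measure_ball_pos _ _ hc0).ne')
      measure_ball_lt_top.ne, ?_⟩
  filter_upwards [Ioc_mem_nhdsGT hr₀] with r hr
  have h0 : ENNReal.ofReal (r ^ Module.finrank ℝ (E d)) ≠ 0 := by
    simpa using pow_pos hr.1 _
  have hb0 : volume (Metric.ball (0 : E d) 1) ≠ 0 := (Metric.measure_ball_pos _ _ one_pos).ne'
  calc (volume (Metric.ball x r ∩ Ω))⁻¹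
      ≤ (volume (Metric.ball (x + (r / 2) • e) (r * c)))⁻¹ :=
        ENNReal.inv_le_inv.2 (measure_mono (hsub r hr.1 hr.2))
    _ = (ENNReal.ofReal (r ^ Module.finrank ℝ (E d)))⁻¹ * (volume (Metric.ball (0 : E d) c))⁻¹ := by
        rw [Measure.addHaar_ball_mul_of_pos _ _ hr.1,
          ENNReal.mul_inv (Or.inl h0) (Or.inl ENNReal.ofReal_ne_top)]
    _ = (volume (Metric.ball (0 : E d) c))⁻¹ * volume (Metric.ball (0 : E d) 1)
          * (volume (Metric.ball x r))⁻¹ := by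
        rw [Measure.addHaar_ball_of_pos _ _ hr.1,
          ENNReal.mul_inv (Or.inl h0) (Or.inl ENNReal.ofReal_ne_top), mul_comm, mul_assoc]
        congr 1
        rw [mul_left_comm, ENNReal.mul_inv_cancel hb0 measure_ball_lt_top.ne, mul_one]

/-- A trace on `Γ` from a neighbourhood `Ω` of `Γ` is also the trace from a one-sided Lipschitz
neighbourhood `Ω'` of `Γ`. -/
theorem HasTrace.of_lipschitz_side {Ω Ω' Γ : Set (E d)} {v g : E d → ℝ} (h : HasTrace Ω Γ v g)
    (hΩ : IsOpen Ω) (hΩ' : HasLipschitzBoundary Ω') (hΓ : MeasurableSet Γ)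
    (hΓΩ : Γ ⊆ Ω) (hΓΩ' : Γ ⊆ frontier Ω') : HasTrace Ω' Γ v g := by
  filter_upwards [h, ae_restrict_mem hΓ] with x hx hxΓ
  obtain ⟨C, hC, hCr⟩ := hΩ'.inv_volume_ball_inter_le (hΓΩ' hxΓ)
  obtain ⟨r₀, hr₀, hball⟩ := Metric.isOpen_iff.1 hΩ x (hΓΩ hxΓ)
  have hlim := ENNReal.Tendsto.const_mul (a := C) hx (Or.inr hC)
  rw [mul_zero] at hlim
  refine tendsto_of_tendsto_of_tendsto_of_le_of_le' tendsto_const_nhds hlim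
    (Eventually.of_forall fun _ => zero_le) ?_
  filter_upwards [hCr, Ioc_mem_nhdsGT hr₀] with r hr hr'
  have hsub : Metric.ball x r ⊆ Ω := (Metric.ball_subset_ball hr'.2).trans hball
  rw [inter_eq_self_of_subset_left hsub, setLAverage_eq, setLAverage_eq, div_eq_mul_inv,
    div_eq_mul_inv, mul_left_comm]
  exact mul_le_mul' (lintegral_mono_set inter_subset_left) hr

/-- Only small balls centred on `Γ` enter the limit, so the function may be changed away from `Γ`.
This serves the cut-off to the overlap, which is altered only off a neighbourhood of the port. -/
theorem HasTrace.congr_of_isOpen {Ω O Γ : Set (E d)} {v v' g : E d → ℝ} (h : HasTrace Ω Γ v g)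
    (hO : IsOpen O) (hΓ : MeasurableSet Γ) (hΓO : Γ ⊆ O)
    (hv : v' =ᵐ[volume.restrict (Ω ∩ O)] v) : HasTrace Ω Γ v' g := by
  filter_upwards [h, ae_restrict_mem hΓ] with x hx hxΓ
  obtain ⟨r₀, hr₀, hball⟩ := Metric.isOpen_iff.1 hO x (hΓO hxΓ)
  refine hx.congr' ?_
  filter_upwards [Ioc_mem_nhdsGT hr₀] with r hr
  refine laverage_congr ?_
  have hsub : Metric.ball x r ∩ Ω ⊆ Ω ∩ O := fun y hy =>
    ⟨hy.2, hball (Metric.ball_subset_ball hr.2 hy.1)⟩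
  filter_upwards [ae_mono (Measure.restrict_mono_set volume hsub) hv] with y hy
  rw [hy]

/-- Multiplication by a Lipschitz function vanishing on `Γ` annihilates traces on `Γ`. -/
theorem HasTrace.mul_of_lipschitzOnWith {Ω S Γ : Set (E d)} {v g φ : E d → ℝ} {K : ℝ≥0}
    (h : HasTrace Ω Γ v g) (hφ : LipschitzOnWith K φ S) (hΩ : MeasurableSet Ω)
    (hΓ : MeasurableSet Γ) (hΩS : Ω ⊆ S) (hΓS : Γ ⊆ S) (hφΓ : ∀ x ∈ Γ, φ x = 0) :
    HasTrace Ω Γ (fun y => φ y * v y) 0 := by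
  filter_upwards [h, ae_restrict_mem hΓ] with x hx hxΓ
  have hr : Tendsto (fun r : ℝ => (K : ℝ≥0∞) * ENNReal.ofReal r) (𝓝[>] 0) (𝓝 0) := by
    have := ENNReal.Tendsto.const_mul (a := (K : ℝ≥0∞))
      ((ENNReal.continuous_ofReal.tendsto 0).mono_left (nhdsWithin_le_nhds (s := Ioi 0)))
      (Or.inr ENNReal.coe_ne_top)
    simpa using this
  have hlim := ENNReal.Tendsto.mul hr (Or.inr (by simp)) (hx.add_const ‖g x‖ₑ)
    (Or.inr ENNReal.zero_ne_top)
  rw [zero_mul] at hlim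
  refine tendsto_of_tendsto_of_tendsto_of_le_of_le tendsto_const_nhds hlim
    (fun _ => zero_le) fun r => ?_
  -- As `φ` vanishes at `x`, it is at most `K r` on the ball, while the averages of `|v|` stay
  -- bounded by those of `|v - g x|` plus `|g x|`.
  have hbound : ∀ y ∈ Metric.ball x r ∩ Ω, ‖φ y * v y - (0 : E d → ℝ) x‖ₑ
      ≤ (K * ENNReal.ofReal r) * (‖v y - g x‖ₑ + ‖g x‖ₑ) := by
    intro y hy
    have h1 : ‖φ y‖ₑ ≤ K * ENNReal.ofReal r := by
      have := hφ (hΩS hy.2) (hΓS hxΓ)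
      rw [hφΓ x hxΓ, edist_zero_right] at this
      refine this.trans (mul_le_mul_right ?_ _)
      rw [edist_dist]
      exact ENNReal.ofReal_le_ofReal (Metric.mem_ball.1 hy.1).le
    rw [Pi.zero_apply, sub_zero, enorm_mul]
    refine mul_le_mul' h1 ?_
    simpa using enorm_add_le (v y - g x) (g x)
  have hK : (K : ℝ≥0∞) * ENNReal.ofReal r ≠ (⊤ : ℝ≥0∞) :=
    ENNReal.mul_ne_top ENNReal.coe_ne_top ENNReal.ofReal_ne_top
  rw [setLAverage_eq, setLAverage_eq]
  refine (ENNReal.div_le_div_right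
    (setLIntegral_mono' (Metric.isOpen_ball.measurableSet.inter hΩ) hbound) _).trans ?_
  rw [lintegral_const_mul' _ _ hK, lintegral_add_right _ measurable_const, setLIntegral_const,
    mul_div_assoc, ENNReal.add_div, mul_div_assoc]
  gcongr
  exact mul_le_of_le_one_right' ENNReal.div_self_le_one

theorem HasTrace.sub {Ω Γ : Set (E d)} {v v' g g' : E d → ℝ} (h : HasTrace Ω Γ v g)
    (h' : HasTrace Ω Γ v' g') (hv : AEMeasurable v (volume.restrict Ω)) :
    HasTrace Ω Γ (v - v') (g - g') := by
  simpa [sub_eq_add_neg] using h.add (h'.smul (-1)) hv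

/-! ### Elements of `H¹` are determined by their functions -/

theorem H1.fn_sub {Ω : Set (E d)} (u v : H1 Ω) :
    H1.fn (u - v) =ᵐ[volume.restrict Ω] u.fn - v.fn :=
  Lp.coeFn_sub _ _

/-- Weak gradients on an open set are unique by the fundamental lemma of the calculus of variations,
so the gradient component carries no extra information. -/
theorem H1.ext_fn {Ω : Set (E d)} (hΩ : IsOpen Ω) {u v : H1 Ω}
    (h : u.fn =ᵐ[volume.restrict Ω] v.fn) : u = v := by
  have h1 : u.pair.fst = v.pair.fst := Lp.ext h
  have hint : ∀ w : H1 Ω, ∀ ψ, IsTest Ω ψ →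
      Integrable (fun x => ψ x • w.pair.snd x) (volume.restrict Ω) := fun w ψ hψ =>
    memLp_one_iff_integrable.1 (MemLp.smul (Lp.memLp w.pair.snd) hψ.memLp)
  have hloc : ∀ w : H1 Ω, LocallyIntegrableOn (w.pair.snd : E d → E d) Ω volume := fun w =>
    locallyIntegrableOn_of_locallyIntegrable_restrict
      ((Lp.memLp w.pair.snd).locallyIntegrable (by norm_num))
  have h2 : u.pair.snd = v.pair.snd := by
    apply Lp.ext
    have key := hΩ.ae_eq_zero_of_integral_contDiff_smul_eq_zero
      (f := fun x => u.pair.snd x - v.pair.snd x) (μ := volume) ((hloc u).sub (hloc v)) ?_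
    · filter_upwards [(ae_restrict_iff' hΩ.measurableSet).2 key] with x hx
      exact sub_eq_zero.1 hx
    · intro ψ hψ hψc hψs
      have hψt : IsTest Ω ψ := ⟨hψ, hψc, hψs⟩
      rw [← setIntegral_eq_integral_of_forall_compl_eq_zero (s := Ω) fun x hx => by
        rw [image_eq_zero_of_notMem_tsupport fun hx' => hx (hψs hx'), zero_smul]]
      simp_rw [smul_sub]
      rw [integral_sub (hint u ψ hψt) (hint v ψ hψt), sub_eq_zero]
      have hu : ∫ x in Ω, u.pair.fst x • gradient ψ x = -∫ x in Ω, ψ x • u.pair.snd x :=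
        u.property ψ hψt
      have hv : ∫ x in Ω, v.pair.fst x • gradient ψ x = -∫ x in Ω, ψ x • v.pair.snd x :=
        v.property ψ hψt
      rw [h1, hv] at hu
      exact (neg_injective hu).symm
  apply Subtype.ext
  apply WithLp.ofLp_injective 2
  exact Prod.ext h1 h2

end Auxiliary

/-! ### Inf-sup and continuity constants of compact perturbations of the identity -/

section Constants

variable {V : Type*} [NormedAddCommGroup V] [InnerProductSpace ℝ V]

/-- Unit vectors with `l - T l` tending to 0 would accumulate, by compactness, at a unit fixed
vector. The limit lies in `V` already, so `V` need not be complete. -/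
theorem exists_norm_le_mul_norm_sub_of_isCompactOperator {T : V →ₗ[ℝ] V}
    (hT : IsCompactOperator T) (hinj : ∀ l, T l = l → l = 0) :
    ∃ C : ℝ, 0 < C ∧ ∀ l, C * ‖l‖ ≤ ‖l - T l‖ := by
  let S : V →L[ℝ] V := ⟨T, hT.continuous⟩
  have hS : IsCompactOperator S := hT
  obtain ⟨K, hK⟩ := hS.antilipschitz_of_not_hasEigenvalue (μ := 1) one_ne_zero (by
    intro hev
    obtain ⟨l, hl⟩ := hev.exists_hasEigenvector
    exact hl.2 (hinj l (by simpa [S] using hl.apply_eq_smul)))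
  obtain ⟨C, hC, h⟩ := (antilipschitzWith_iff_exists_mul_le_norm (f := S - (1 : ℝ) • 1)).1 ⟨K, hK⟩
  refine ⟨C, hC, fun l => (h l).trans_eq ?_⟩
  rw [norm_sub_rev]
  simp [S]

theorem infSupConstant_pos {A : V → V} {C : ℝ} (hC : 0 < C) (hA : ∀ w, C * ‖w‖ ≤ ‖A w‖) :
    0 < infSupConstant fun w v => inner ℝ (A w) v := by
  refine (EReal.coe_pos.2 hC).trans_le (le_iInf₂ fun w hw => ?_)
  have hw' : 0 < ‖w‖ := norm_pos_iff.2 hw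
  have hAw : 0 < ‖A w‖ := (mul_pos hC hw').trans_le (hA w)
  -- The test vector `A w` is nonzero by the lower bound and attains the quotient `‖A w‖ / ‖w‖`.
  refine le_iSup₂_of_le (A w) (norm_pos_iff.1 hAw) (EReal.coe_le_coe_iff.2 ?_)
  beta_reduce
  rw [real_inner_self_eq_norm_sq, le_div_iff₀ (by positivity), sq, ← mul_assoc]
  exact mul_le_mul_of_nonneg_right (hA w) hAw.le

theorem continuityConstant_lt_top {A : V → V} {C : ℝ} (hA : ∀ w, ‖A w‖ ≤ C * ‖w‖) :
    continuityConstant (fun w v => inner ℝ (A w) v) < ⊤ := by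
  refine lt_of_le_of_lt (iSup₂_le fun w hw => iSup₂_le fun v hv => ?_) (EReal.coe_lt_top C)
  have hw' : 0 < ‖w‖ := norm_pos_iff.2 hw
  have hv' : 0 < ‖v‖ := norm_pos_iff.2 hv
  rw [EReal.coe_le_coe_iff, div_le_iff₀ (by positivity), ← mul_assoc]
  exact (real_inner_le_norm _ _).trans (mul_le_mul_of_nonneg_right (hA w) hv'.le)

end Constants

/-! ### The alternating Schwarz fixed point -/

namespace Decomposition

variable {d : ℕ} (D : Decomposition d)

theorem isOpen_dom : IsOpen D.dom := isOpen_iUnion D.isOpen_sub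

theorem measurableSet_port (i : Fin 2) : MeasurableSet (D.port i) :=
  isClosed_frontier.measurableSet.inter D.isOpen_dom.measurableSet

theorem notMem_sub_of_mem_port {i : Fin 2} {x : E d} (hx : x ∈ D.port i) : x ∉ D.sub i := by
  have h := hx.1
  rw [(D.isOpen_sub i).frontier_eq] at h
  exact h.2

theorem mem_dom_iff (i : Fin 2) {x : E d} : x ∈ D.dom ↔ x ∈ D.sub i ∨ x ∈ D.sub i.rev := by
  rw [dom, mem_iUnion]
  fin_cases i
  · exact Fin.exists_fin_two
  · exact Fin.exists_fin_two.trans or_comm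

theorem port_subset (i : Fin 2) : D.port i ⊆ D.sub i.rev := fun _ hx =>
  ((D.mem_dom_iff i).1 hx.2).resolve_left (D.notMem_sub_of_mem_port hx)

theorem ae_sub_of_ae_dom {p : E d → Prop} (i : Fin 2)
    (h : ∀ᵐ x ∂volume.restrict D.dom, p x) : ∀ᵐ x ∂volume.restrict (D.sub i), p x :=
  ae_mono (Measure.restrict_mono_set volume (D.sub_subset i)) h

/-! ### Bubbles and the locality of the form -/

variable {D} {X : Submodule ℝ (H1 D.dom)}

theorem toLocal_ae (i : Fin 2) (u : X) :
    H1.fn (D.toLocal X i u : H1 (D.sub i)) =ᵐ[volume.restrict (D.sub i)] H1.fn (u : H1 D.dom) :=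
  H1.restrict_ae _ _

theorem toLocal_surjective (i : Fin 2) : Function.Surjective (D.toLocal X i) := by
  rintro ⟨_, u, hu, rfl⟩
  exact ⟨⟨u, hu⟩, rfl⟩

theorem toLocal_eq_of_ae {i : Fin 2} {u u' : X}
    (h : H1.fn (u : H1 D.dom) =ᵐ[volume.restrict (D.sub i)] H1.fn (u' : H1 D.dom)) :
    D.toLocal X i u = D.toLocal X i u' :=
  Subtype.ext (H1.ext_fn (D.isOpen_sub i)
    ((toLocal_ae i u).trans (h.trans (toLocal_ae i u').symm)))

/-- `w ∈ X` is the trivial extension of its restriction to `Ω_i`, and this restriction is in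
`X_{i,0}`. -/
structure IsBubble (i : Fin 2) (w : X) : Prop where
  hasTrace : HasTrace (D.sub i) (D.port i) (H1.fn (w : H1 D.dom)) 0
  eq_zero : ∀ᵐ x ∂volume.restrict D.dom, x ∉ D.sub i → H1.fn (w : H1 D.dom) x = 0

theorem toLocal_mem_bubbleSpace {i : Fin 2} {w : X}
    (h : HasTrace (D.sub i) (D.port i) (H1.fn (w : H1 D.dom)) 0) :
    (D.toLocal X i w : H1 (D.sub i)) ∈ D.bubbleSpace X i :=
  ⟨(D.toLocal X i w).2, h.congr (toLocal_ae i w) HHalf.fn_zero⟩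

theorem exists_isZeroExtension
    (hX_ext : ∀ i, ∀ v ∈ D.bubbleSpace X i, ∃ w ∈ X, D.IsZeroExtension i v w) {i : Fin 2} {u : X}
    (h : HasTrace (D.sub i) (D.port i) (H1.fn (u : H1 D.dom)) 0) :
    ∃ w : X, H1.fn (w : H1 D.dom) =ᵐ[volume.restrict D.dom]
      (D.sub i).indicator (H1.fn (u : H1 D.dom)) := by
  obtain ⟨w, hw, hext⟩ := hX_ext i _ (toLocal_mem_bubbleSpace h)
  refine ⟨⟨w, hw⟩, hext.trans (ae_restrict_of_ae ?_)⟩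
  filter_upwards [(ae_restrict_iff' (D.isOpen_sub i).measurableSet).1 (toLocal_ae i u)] with x hx
  by_cases hxi : x ∈ D.sub i
  · simp [hxi, hx hxi]
  · simp [hxi]

theorem IsBubble.form_eq {a : X →L[ℝ] X →L[ℝ] ℝ} {b : D.LocalForms X}
    (hab : ∀ (i : Fin 2) (u : X) (v : D.bubbleSpace X i) (w : X),
      D.IsZeroExtension i v w → a u w = b i (D.toLocal X i u) v)
    {i : Fin 2} {w : X} (hw : IsBubble i w) (u : X) :
    a u w = b i (D.toLocal X i u) ⟨_, toLocal_mem_bubbleSpace hw.hasTrace⟩ := by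
  refine hab i u _ w ?_
  filter_upwards [hw.eq_zero, ae_restrict_of_ae
    ((ae_restrict_iff' (D.isOpen_sub i).measurableSet).1 (toLocal_ae i w))] with x hx hx'
  by_cases hxi : x ∈ D.sub i
  · simp [hxi, hx' hxi]
  · simp [hxi, hx hxi]

/-- Locality in usable form: against a bubble of `Ω_i`, the first argument may be altered freely
outside `Ω_i`. -/
theorem IsBubble.form_congr {a : X →L[ℝ] X →L[ℝ] ℝ} {b : D.LocalForms X}
    (hab : ∀ (i : Fin 2) (u : X) (v : D.bubbleSpace X i) (w : X),
      D.IsZeroExtension i v w → a u w = b i (D.toLocal X i u) v)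
    {i : Fin 2} {w : X} (hw : IsBubble i w) {u u' : X} (h : D.toLocal X i u = D.toLocal X i u') :
    a u w = a u' w := by
  rw [hw.form_eq hab, hw.form_eq hab, h]

/-- The trace on `Γ_i` of a function on `Ω_j ⊇ Γ_i`, `j ≠ i`, is also its trace from the side
of `Ω_i`. -/
theorem hasTrace_sub_of_rev {i : Fin 2} {v g : E d → ℝ}
    (h : HasTrace (D.sub i.rev) (D.port i) v g) : HasTrace (D.sub i) (D.port i) v g :=
  h.of_lipschitz_side (D.isOpen_sub _) (D.lipschitz_sub i) (D.measurableSet_port i)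
    (D.port_subset i) inter_subset_left

/-- Local solutions which agree on both ports vanish. -/
theorem eq_zero_of_local_solutions {φ : Fin 2 → E d → ℝ} (hφ : D.IsPartitionOfUnity φ)
    (hX_ext : ∀ i, ∀ v ∈ D.bubbleSpace X i, ∃ w ∈ X, D.IsZeroExtension i v w)
    (hX_mul : ∀ i, ∀ u ∈ X, ∃ w ∈ X,
      w.fn =ᵐ[volume.restrict D.dom] fun x => φ i x * u.fn x)
    {a : X →L[ℝ] X →L[ℝ] ℝ} (ha : IsCoercive a) {b : D.LocalForms X}
    (hab : ∀ (i : Fin 2) (u : X) (v : D.bubbleSpace X i) (w : X),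
      D.IsZeroExtension i v w → a u w = b i (D.toLocal X i u) v)
    {u : ∀ i, D.localSpace X i} {g : Fin 2 → E d → ℝ}
    (hsol : ∀ i v, b i (u i) v = 0)
    (htrace : ∀ i, HasTrace (D.sub i) (D.port i) (H1.fn (u i : H1 (D.sub i))) (g i))
    (hcross : ∀ i, HasTrace (D.sub i.rev) (D.port i)
      (H1.fn (u i.rev : H1 (D.sub i.rev))) (g i)) (i : Fin 2) : u i = 0 := by
  have hzero : ∀ w : X, a w w = 0 → w = 0 := by
    obtain ⟨c, hc, hcoer⟩ := ha
    intro w hw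
    have h := hcoer w
    rw [hw, mul_assoc] at h
    by_contra hne
    have := norm_pos_iff.2 hne
    exact absurd h (not_le.2 (by positivity))
  choose U hU using fun i => toLocal_surjective (X := X) i (u i)
  have hUae : ∀ i, H1.fn (u i : H1 (D.sub i)) =ᵐ[volume.restrict (D.sub i)]
      H1.fn (U i : H1 D.dom) := fun i => hU i ▸ toLocal_ae i (U i)
  have hUtr : ∀ i, HasTrace (D.sub i) (D.port i) (H1.fn (U i : H1 D.dom)) (g i) := fun i =>
    (htrace i).congr (hUae i).symm EventuallyEq.rfl
  have hUcross : ∀ i, HasTrace (D.sub i) (D.port i) (H1.fn (U i.rev : H1 D.dom)) (g i) := fun i =>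
    hasTrace_sub_of_rev ((hcross i).congr (hUae _).symm EventuallyEq.rfl)
  have hmeas : ∀ i j, AEMeasurable (H1.fn (U j : H1 D.dom)) (volume.restrict (D.sub i)) :=
    fun i j => ((U j : H1 D.dom).memLp_fn.aestronglyMeasurable.aemeasurable).mono_measure
      (Measure.restrict_mono_set volume (D.sub_subset i))
  have hVae : H1.fn ((U 0 - U 1 : X) : H1 D.dom) =ᵐ[volume.restrict D.dom]
      H1.fn (U 0 : H1 D.dom) - H1.fn (U 1 : H1 D.dom) := H1.fn_sub _ _
  -- On each port one of `U 0`, `U 1` has the trace `g i` as its own datum and the other by the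
  -- crossing condition, so the traces cancel.
  have hV : ∀ i, HasTrace (D.sub i) (D.port i) (H1.fn ((U 0 - U 1 : X) : H1 D.dom)) 0 := by
    refine Fin.forall_fin_two.2 ⟨?_, ?_⟩
    · have h := (hUtr 0).sub (hUcross 0) (hmeas 0 0)
      rw [sub_self] at h
      exact h.congr (D.ae_sub_of_ae_dom 0 hVae) EventuallyEq.rfl
    · have h := (hUcross 1).sub (hUtr 1) (hmeas 1 0)
      rw [sub_self] at h
      exact h.congr (D.ae_sub_of_ae_dom 1 hVae) EventuallyEq.rfl
  choose Z hZ using fun i => exists_isZeroExtension hX_ext (hV i)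
  set V : X := U 0 - U 1 with hVdef
  have hsum : H1.fn ((Z 0 + Z 1 - V : X) : H1 D.dom) =ᵐ[volume.restrict D.dom]
      H1.fn (Z 0 : H1 D.dom) + H1.fn (Z 1 : H1 D.dom) - H1.fn (V : H1 D.dom) :=
    (H1.fn_sub _ _).trans ((H1.fn_add _ _).sub EventuallyEq.rfl)
  -- By inclusion–exclusion `W` is `V` on the overlap and 0 elsewhere. Building it from zero
  -- extensions keeps it in `X`.
  set W : X := Z 0 + Z 1 - V
  have hdom : ∀ᵐ x ∂volume.restrict D.dom, x ∈ D.dom := ae_restrict_mem D.isOpen_dom.measurableSet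
  have hW : H1.fn (W : H1 D.dom) =ᵐ[volume.restrict D.dom]
      (D.sub 0 ∩ D.sub 1).indicator (H1.fn (V : H1 D.dom)) := by
    filter_upwards [hsum, hZ 0, hZ 1, hdom] with x h h0 h1 hx
    rw [h, Pi.sub_apply, Pi.add_apply, h0, h1]
    have hx' : x ∈ D.sub 0 ∨ x ∈ D.sub 1 := (D.mem_dom_iff 0).1 hx
    by_cases hx0 : x ∈ D.sub 0
    · by_cases hx1 : x ∈ D.sub 1 <;> simp [hx0, hx1]
    · simp [hx0, hx'.resolve_left hx0]
  -- `Γ_i` lies in the open set `Ω_{i.rev}`; near it, on the side of `Ω_i`, `W` is `V` and inherits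
  -- the zero trace.
  have hWbubble : ∀ i, IsBubble i W := by
    intro i
    have hmem : ∀ x, x ∈ D.sub i → x ∈ D.sub i.rev → x ∈ D.sub 0 ∩ D.sub 1 := by
      fin_cases i
      · exact fun x h h' => ⟨h, h'⟩
      · exact fun x h h' => ⟨h', h⟩
    have hnot : ∀ x, x ∉ D.sub i → x ∉ D.sub 0 ∩ D.sub 1 := by
      fin_cases i
      · exact fun x h h' => h h'.1
      · exact fun x h h' => h h'.2
    constructor
    · refine (hV i).congr_of_isOpen (D.isOpen_sub i.rev) (D.measurableSet_port i)
        (D.port_subset i) ?_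
      filter_upwards [ae_mono (Measure.restrict_mono_set volume
        (inter_subset_left.trans (D.sub_subset i))) hW, ae_restrict_mem
        ((D.isOpen_sub i).inter (D.isOpen_sub i.rev)).measurableSet] with x hx hx'
      rw [hx, indicator_of_mem (hmem x hx'.1 hx'.2)]
    · filter_upwards [hW] with x hx hxi
      rw [hx, indicator_of_notMem (hnot x hxi)]
  -- `W` agrees with `Z 1` on `Ω_0`, and `Z 1` with `V` on `Ω_1`. As `W` is a bubble for both, `a(W,
  -- W) = a(Z 1, W) = a(V, W) = a(U 0, W) - a(U 1, W)`, and both terms vanish by the local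
  -- equations.
  have hW0 : W = 0 := by
    refine hzero W ?_
    have hZV : D.toLocal X 1 (Z 1) = D.toLocal X 1 V := by
      refine toLocal_eq_of_ae ?_
      filter_upwards [D.ae_sub_of_ae_dom 1 (hZ 1),
        ae_restrict_mem (D.isOpen_sub 1).measurableSet] with x hx hx1
      rw [hx, indicator_of_mem hx1]
    have hWZ : D.toLocal X 0 W = D.toLocal X 0 (Z 1) := by
      refine toLocal_eq_of_ae ?_
      filter_upwards [D.ae_sub_of_ae_dom 0 hW, D.ae_sub_of_ae_dom 0 (hZ 1),
        ae_restrict_mem (D.isOpen_sub 0).measurableSet] with x hx hx' hx0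
      rw [hx, hx']
      by_cases hx1 : x ∈ D.sub 1 <;> simp [hx0, hx1]
    have hsolW : ∀ i, a (U i) W = 0 := fun i => by
      rw [(hWbubble i).form_eq hab, hU i, hsol]
    rw [(hWbubble 0).form_congr hab hWZ, (hWbubble 1).form_congr hab hZV, hVdef, a.map_sub,
      sub_apply, hsolW, hsolW, sub_zero]
  have hagree : ∀ᵐ x ∂volume.restrict D.dom, x ∈ D.sub 0 → x ∈ D.sub 1 →
      H1.fn (U 0 : H1 D.dom) x = H1.fn (U 1 : H1 D.dom) x := by
    have hW0' : H1.fn (W : H1 D.dom) =ᵐ[volume.restrict D.dom] 0 := by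
      rw [hW0]
      exact H1.fn_zero
    filter_upwards [hW, hW0', hVae] with x h h0 hv hx0 hx1
    rw [h0, indicator_of_mem (show x ∈ D.sub 0 ∩ D.sub 1 from ⟨hx0, hx1⟩), hv] at h
    exact (sub_eq_zero.1 h.symm)
  have hG : H1.fn ((U 1 + Z 0 : X) : H1 D.dom) =ᵐ[volume.restrict D.dom]
      H1.fn (U 1 : H1 D.dom) + H1.fn (Z 0 : H1 D.dom) := H1.fn_add _ _
  -- The glued function: adding `V = U 0 - U 1` on `Ω_0` turns `U 1` into `U 0` there, and on `Ω_1`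
  -- nothing changes because `V = 0` on the overlap.
  set G : X := U 1 + Z 0
  have hGU : ∀ i, H1.fn (G : H1 D.dom) =ᵐ[volume.restrict (D.sub i)] H1.fn (U i : H1 D.dom) := by
    refine Fin.forall_fin_two.2 ⟨?_, ?_⟩
    · filter_upwards [D.ae_sub_of_ae_dom 0 hG, D.ae_sub_of_ae_dom 0 (hZ 0),
        D.ae_sub_of_ae_dom 0 hVae, ae_restrict_mem (D.isOpen_sub 0).measurableSet]
        with x h h0 hv hx0
      rw [h, Pi.add_apply, h0, indicator_of_mem hx0, hv, Pi.sub_apply]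
      ring
    · filter_upwards [D.ae_sub_of_ae_dom 1 hG, D.ae_sub_of_ae_dom 1 (hZ 0),
        D.ae_sub_of_ae_dom 1 hVae, D.ae_sub_of_ae_dom 1 hagree,
        ae_restrict_mem (D.isOpen_sub 1).measurableSet] with x h h0 hv hag hx1
      rw [h, Pi.add_apply, h0]
      by_cases hx0 : x ∈ D.sub 0
      · rw [indicator_of_mem hx0, hv, Pi.sub_apply, hag hx0 hx1]
        ring
      · rw [indicator_of_notMem hx0, add_zero]
  choose P hPX hP using fun i => hX_mul i G G.2
  have hPbubble : ∀ i, IsBubble i (⟨P i, hPX i⟩ : X) := by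
    intro i
    constructor
    · obtain ⟨K, hK⟩ := hφ.lipschitz i
      have h := (hUtr i).mul_of_lipschitzOnWith hK (D.isOpen_sub i).measurableSet
        (D.measurableSet_port i) (D.sub_subset i) inter_subset_right
        fun x hx => hφ.eq_zero i x hx.2 (D.notMem_sub_of_mem_port hx)
      refine h.congr ?_ EventuallyEq.rfl
      filter_upwards [D.ae_sub_of_ae_dom i (hP i), hGU i] with x hx hx'
      rw [hx, hx']
    · filter_upwards [hP i, hdom] with x hx hxd hxi
      rw [hx, hφ.eq_zero i x hxd hxi, zero_mul]
  have hGU' : ∀ i, D.toLocal X i G = u i := fun i => (toLocal_eq_of_ae (hGU i)).trans (hU i)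
  have hGP : G = ⟨P 0, hPX 0⟩ + ⟨P 1, hPX 1⟩ := by
    refine Subtype.ext (H1.ext_fn D.isOpen_dom ?_)
    filter_upwards [hP 0, hP 1, H1.fn_add (P 0) (P 1), hdom] with x h0 h1 h hx
    refine Eq.trans ?_ h.symm
    rw [Pi.add_apply, h0, h1, ← add_mul, ← Fin.sum_univ_two (fun i => φ i x),
      hφ.sum_eq_one x hx, one_mul]
  have hG0 : G = 0 := by
    refine hzero G ?_
    -- Only the second argument is split: the first must stay `G`, whose restrictions are the local
    -- solutions.
    conv_lhs => rw [congrArg (a G) hGP]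
    rw [map_add, (hPbubble 0).form_eq hab, (hPbubble 1).form_eq hab, hGU', hGU', hsol, hsol,
      add_zero]
  rw [← hGU' i, hG0, map_zero]

end Decomposition

/-! ### From fixed points of the port operator to local solutions -/

theorem linearOfGraph_mem_or_eq_zero {M N : Type*} [AddCommGroup M] [Module ℝ M] [AddCommGroup N]
    [Module ℝ N] (R : Submodule ℝ (M × N)) :
    (∀ x, (x, linearOfGraph R x) ∈ R) ∨ linearOfGraph R = 0 := by
  by_cases h : ∀ x, ∃! y, (x, y) ∈ R
  · exact Or.inl (linearOfGraph_mem R h)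
  · exact Or.inr (dif_neg h)

namespace Decomposition

variable {d : ℕ} {D : Decomposition d} {X : Submodule ℝ (H1 D.dom)}

theorem localSolve_spec_or_eq_zero (b : D.LocalForms X) (i : Fin 2) :
    (∀ l : D.portSpace X i,
      (D.localSolve b i l : H1 (D.sub i)).IsTrace (l : HHalf (D.port i)) ∧
        ∀ v, b i (D.localSolve b i l) v = 0) ∨ D.localSolve b i = 0 := by
  unfold localSolve
  exact (linearOfGraph_mem_or_eq_zero _).imp_left fun h l => h l

theorem crossTrace_spec_or_eq_zero (i : Fin 2) :
    (∀ v : D.localSpace X i.rev,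
      (v : H1 (D.sub i.rev)).IsTrace (D.crossTrace X i v : HHalf (D.port i))) ∨
        D.crossTrace X i = 0 := by
  unfold crossTrace
  exact (linearOfGraph_mem_or_eq_zero _).imp_left fun h l => h l

theorem portOperator_apply (b : D.LocalForms X) (l : D.Ports X) (i : Fin 2) :
    D.portOperator b l i = D.crossTrace X i (D.localSolve b i.rev (l i.rev)) :=
  rfl

/-- The port operator has no nonzero fixed point. The well-posedness of the local problems and of
the traces is not needed: an operator whose graph is not single-valued is `0` by convention, and
then a fixed point vanishes by linearity. -/
theorem eq_zero_of_portOperator_eq_self {φ : Fin 2 → E d → ℝ} (hφ : D.IsPartitionOfUnity φ)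
    (hX_ext : ∀ i, ∀ v ∈ D.bubbleSpace X i, ∃ w ∈ X, D.IsZeroExtension i v w)
    (hX_mul : ∀ i, ∀ u ∈ X, ∃ w ∈ X,
      w.fn =ᵐ[volume.restrict D.dom] fun x => φ i x * u.fn x)
    {a : X →L[ℝ] X →L[ℝ] ℝ} (ha : IsCoercive a) {b : D.LocalForms X}
    (hab : ∀ (i : Fin 2) (u : X) (v : D.bubbleSpace X i) (w : X),
      D.IsZeroExtension i v w → a u w = b i (D.toLocal X i u) v)
    {l : D.Ports X} (hl : D.portOperator b l = l) : l = 0 := by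
  have hfix : ∀ i, l i = D.crossTrace X i (D.localSolve b i.rev (l i.rev)) := fun i => by
    rw [← portOperator_apply, hl]
  have hstep : ∀ i : Fin 2, D.localSolve b i.rev (l i.rev) = 0 → l i = 0 := fun i h => by
    rw [hfix i, h, map_zero]
  -- The port operator exchanges the two components, so a fixed point with one zero component has
  -- both zero.
  have hone : ∀ i : Fin 2, l i.rev = 0 → l = 0 := by
    refine Fin.forall_fin_two.2 ⟨fun h => ?_, fun h => ?_⟩
    · ext1 i
      revert i
      exact Fin.forall_fin_two.2 ⟨hstep 0 (by rw [h, map_zero]), h⟩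
    · ext1 i
      revert i
      exact Fin.forall_fin_two.2 ⟨h, hstep 1 (by rw [h, map_zero])⟩
  -- If some `T_i` takes the default value 0, the component on the other port vanishes.
  by_cases hS : ∃ i, D.localSolve b i = 0
  · obtain ⟨i, hi⟩ := hS
    refine hone i (hstep i.rev ?_)
    revert hi
    fin_cases i
    · exact fun hi => by
        change D.localSolve b 0 (l 0) = 0
        rw [show D.localSolve b 0 = 0 from hi, LinearMap.zero_apply]
    · exact fun hi => by
        change D.localSolve b 1 (l 1) = 0
        rw [show D.localSolve b 1 = 0 from hi, LinearMap.zero_apply]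
  by_cases hC : ∃ i, D.crossTrace X i = 0
  · obtain ⟨i, hi⟩ := hC
    have h0 : l i = 0 := by rw [hfix i, hi, LinearMap.zero_apply]
    revert h0
    fin_cases i
    · exact hone 1
    · exact hone 0
  push Not at hS hC
  have hS' := fun i => (localSolve_spec_or_eq_zero b i).resolve_right (hS i) (l i)
  have hC' := fun i => (crossTrace_spec_or_eq_zero i).resolve_right (hC i)
    (D.localSolve b i.rev (l i.rev))
  -- With the traces taken as `λ_i`, the fixed-point equation is exactly the crossing condition.
  have hu := eq_zero_of_local_solutions hφ hX_ext hX_mul ha hab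
    (u := fun i => D.localSolve b i (l i)) (g := fun i => (l i : HHalf (D.port i)).fn)
    (fun i => (hS' i).2) (fun i => (hS' i).1) fun i => by
      have h := hC' i
      rw [← hfix i] at h
      exact h
  ext1 i
  exact hstep i (hu i.rev)

end Decomposition

end OverlappingSchwarz

theorem mainTheorem2 {d : ℕ} (D : OverlappingSchwarz.Decomposition d)
    (φ : Fin 2 → OverlappingSchwarz.E d → ℝ) (hφ : D.IsPartitionOfUnity φ)
    (X : Submodule ℝ (OverlappingSchwarz.H1 D.dom))
    (hX_closed : IsClosed (X : Set (OverlappingSchwarz.H1 D.dom)))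
    (hX_H10 : OverlappingSchwarz.H10 D.dom ≤ X)
    (hX_ext : ∀ i, ∀ v ∈ D.bubbleSpace X i, ∃ w ∈ X, D.IsZeroExtension i v w)
    (hX_mul : ∀ i, ∀ u ∈ X, ∃ w ∈ X,
      w.fn =ᵐ[MeasureTheory.volume.restrict D.dom] fun x => φ i x * u.fn x)
    (a : X →L[ℝ] X →L[ℝ] ℝ) (ha : IsCoercive a)
    (b : D.LocalForms X)
    (hab : ∀ (i : Fin 2) (u : X) (v : D.bubbleSpace X i) (w : X),
      D.IsZeroExtension i v w → a u w = b i (D.toLocal X i u) v)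
    (hT : IsCompactOperator (D.portOperator b)) :
    0 < OverlappingSchwarz.infSupConstant (D.portForm b) ∧
      OverlappingSchwarz.continuityConstant (D.portForm b) < ⊤ := by
  have hinj : ∀ l, D.portOperator b l = l → l = 0 := fun l hl =>
    OverlappingSchwarz.Decomposition.eq_zero_of_portOperator_eq_self hφ hX_ext hX_mul ha hab hl
  obtain ⟨C, hC, hbelow⟩ :=
    OverlappingSchwarz.exists_norm_le_mul_norm_sub_of_isCompactOperator hT hinj
  -- Compactness gives continuity, and the operator norm of `I - T` is the continuity bound.
  let T : D.Ports X →L[ℝ] D.Ports X := ⟨D.portOperator b, hT.continuous⟩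
  exact ⟨OverlappingSchwarz.infSupConstant_pos hC hbelow,
    OverlappingSchwarz.continuityConstant_lt_top
      (ContinuousLinearMap.id ℝ (D.Ports X) - T).le_opNorm⟩
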